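/- Let $G=(\mathcal V,\mathcal E)$ be a directed graph without self-loops on $n$ agents, $\mathcal V=\{1,\dots,n\}$, let $N_i^-=\{j:(j,i)\in\mathcal E\}$ and $d_{\max}=\max_i |N_i^-|$. Let $\mathcal X\subseteq\mathbb R$ be nonempty, closed and convex, let $P_{\mathcal X}$ be the projection onto $\mathcal X$, and let $L$ be a constant. Each agent $i$ holds a function $h_i:\mathcal X\to\mathbb R$ that is convex and continuously differentiable, with $|h_i'(x)|\le L$ and $|h_i'(x)-h_i'(y)|\le L|x-y|$ on $\mathcal X$, and such that $\arg\min_{\mathcal X}h_i$ is nonempty and compact. Let $(\lambda[t])_{t\ge 0}$ be step sizes with $\lambda[t+1]\le\lambda[t]$, $\sum_t\lambda[t]=\infty$ and $\sum_t\lambda[t]^2<\infty$. The system is synchronous with crash faults: in iteration $t\ge1$ every agent sends its state to its out-neighbors; let $\mathcal N[t]$ be the set of agents that have not crashed by the beginning of iteration $t$, so $\mathcal N[1]=\mathcal V$ and $\mathcal N[t+1]\subseteq\mathcal N[t]$. Agents in $\mathcal N[t+1]$ transmit on all outgoing edges in iteration $t$, agents in $\mathcal N[t]\setminus\mathcal N[t+1]$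 (which crash during iteration $t$) on an arbitrary subset of them, and agents outside $\mathcal N[t]$ send nothing. Let $\mathcal R_i(t)\subseteq N_i^-$ be the set of agents whose message $i$ receives in iteration $t$. Let $\mathcal F$ be the set of agents that crash at some time in the execution (the faulty agents) and $\mathcal N=\mathcal V\setminus\mathcal F$. From arbitrary initial states $x_i[0]\in\mathbb R$, each $i\in\mathcal N[t+1]$ updates in iteration $t\ge 1$ by $$x_i[t]=P_{\mathcal X}\Big[\frac{1}{|\mathcal R_i(t)|+1}\sum_{j\in\mathcal R_i(t)\cup\{i\}}x_j[t-1]-\lambda[t-1]\,h_i'(x_i[t-1])\Big],$$ and $x_i[t]=x_i[t-1]$ for $i\notin\mathcal N[t+1]$. (If $x_i[0]\notin\mathcal X$, any fixed real number may be used for $h_i'(x_i[0])$.) Let $\gamma\ge 1$ be an integer and let $\beta\le \frac{1}{(d_{\max}+1)^{n}}$ be real. Suppose that for every $R\subseteq\mathcal F$ the reduced graph obtained from $G$ by removing all edges incident to nodes of $R$ has a source component of size at least $\gamma$, that is, at least $\gamma$ nodes of $\mathcal V\setminus R$ have a directed path in the reduced graph to every other node of $\mathcal V\setminus R$. Then there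 are weights $\alpha_i\ge 0$ $(i\in\mathcal V)$ with $\sum_{i\in\mathcal V}\alpha_i=1$ and $|\{i\in\mathcal N:\alpha_i\ge\beta\}|\ge\gamma$ (that is, a function $p=\sum_{i\in\mathcal V}\alpha_ih_i\in\widetilde{\mathcal A}(\beta,\gamma)$) and a point $\tilde x\in\arg\min_{x\in\mathcal X}p(x)$ such that $\lim_{t\to\infty}x_i[t]=\tilde x$ for every non-faulty agent $i\in\mathcal N$. -/

import Mathlib

open Filter Topology

noncomputable section

namespace CrashOpt

/-- The set of minimizers of `f` over the constraint set `X`. -/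
def argminOn (X : Set ℝ) (f : ℝ → ℝ) : Set ℝ :=
  {x | x ∈ X ∧ ∀ y ∈ X, f x ≤ f y}

/-- `h : X → ℝ` is an admissible cost function with gradient `h'` and constant `L`.
Only the values of `h` and `h'` on `X` matter; the derivative is taken relative to `X`
(one-sided at an end point of `X`). -/
structure Admissible (X : Set ℝ) (L : ℝ) (h h' : ℝ → ℝ) : Prop where
  convex : ConvexOn ℝ X h
  hasDeriv : ∀ x ∈ X, HasDerivWithinAt h (h' x) X x
  continuous_deriv : ContinuousOn h' X
  lipschitz_deriv : ∀ x ∈ X, ∀ y ∈ X, |h' x - h' y| ≤ L * |x - y|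
  bounded_deriv : ∀ x ∈ X, |h' x| ≤ L
  argmin_nonempty : (argminOn X h).Nonempty
  argmin_compact : IsCompact (argminOn X h)

section Graph

variable {V : Type*}

/-- Maximum incoming degree `d_max`. -/
def maxInDegree [Fintype V] (G : Digraph V) : ℕ :=
  Finset.univ.sup fun i : V => {j : V | G.Adj j i}.ncard

/-- The subgraph of `G` in which all edges incident to a node of `R` are removed. -/
def removeEdgesAt (G : Digraph V) (R : Set V) : Digraph V where
  Adj i j := G.Adj i j ∧ i ∉ R ∧ j ∉ R

/-- Source component of the graph `H` on the node set `W`: the nodes of `W` that have a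
directed path in `H` to every other node of `W`. -/
def sourceComponent (H : Digraph V) (W : Set V) : Set V :=
  {i | i ∈ W ∧ ∀ j ∈ W, j ≠ i → Relation.TransGen H.Adj i j}

/-- A pattern of crash faults in the synchronous network `G`. Iteration `t + 1` leads from time
`t` to time `t + 1`.
* `alive t`: the agents that have not crashed by the end of iteration `t`
  (equivalently, by the beginning of iteration `t + 1`).
* `recv t i`: the agents whose message agent `i` receives in iteration `t + 1`.

An agent that is still alive at the end of an iteration has sent its message on all of its
outgoing edges in that iteration, an agent that crashes during the iteration may have sent it on
any subset of them, and an agent that crashed earlier sends nothing. -/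
structure CrashPattern (G : Digraph V) where
  alive : ℕ → Set V
  recv : ℕ → V → Finset V
  alive_zero : alive 0 = Set.univ
  alive_succ : ∀ t, alive (t + 1) ⊆ alive t
  recv_sound : ∀ t, ∀ i ∈ alive (t + 1), ∀ j ∈ recv t i, G.Adj j i ∧ j ∈ alive t
  recv_complete : ∀ t, ∀ i ∈ alive (t + 1), ∀ j ∈ alive (t + 1), G.Adj j i → j ∈ recv t i

/-- The faulty agents of the execution: those that crash at some time. -/
def CrashPattern.faulty {G : Digraph V} (C : CrashPattern G) : Set V :=
  {i | ∃ t, i ∉ C.alive t}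

/-- The non-faulty agents. -/
def CrashPattern.nonfaulty {G : Digraph V} (C : CrashPattern G) : Set V :=
  C.faultyᶜ

/-- The value `v_i[t]`: plain average of the own estimate and of the received ones
(`i` is not in `recv t i`, as `G` has no self-loops). -/
def CrashPattern.average {G : Digraph V} (C : CrashPattern G) (x : ℕ → V → ℝ) (t : ℕ) (i : V) :
    ℝ :=
  (x t i + ∑ j ∈ C.recv t i, x t j) / ((C.recv t i).card + 1)

/-- `x` is a trajectory of the algorithm (neighbor averaging and projected gradient step) under
the crash pattern `C`: `x t i` is the estimate of agent `i` after iteration `t`. The projection of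
`u` on `X` is the minimizer over `z ∈ X` of `|z - u|`. -/
structure IsTrajectory {G : Digraph V} (C : CrashPattern G) (X : Set ℝ) (h' : V → ℝ → ℝ)
    (lam : ℕ → ℝ) (x : ℕ → V → ℝ) : Prop where
  update : ∀ t, ∀ i ∈ C.alive (t + 1),
    x (t + 1) i ∈ argminOn X fun z => |z - (C.average x t i - lam t * h' i (x t i))|
  crashed : ∀ t, ∀ i ∉ C.alive (t + 1), x (t + 1) i = x t i

/-- The collection of convex combinations of all the local functions in which at least `γ`
non-faulty agents (members of `N`) have weight at least `β`. -/
def validFunctions [Fintype V] (h : V → ℝ → ℝ) (N : Set V) (β : ℝ) (γ : ℕ) : Set (ℝ → ℝ) :=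
  {p | ∃ α : V → ℝ, (∀ i, 0 ≤ α i) ∧ ∑ i, α i = 1 ∧ γ ≤ {i | i ∈ N ∧ β ≤ α i}.ncard ∧
    p = fun x => ∑ i, α i * h i x}

end Graph

/-- Step sizes: non-increasing, not summable, square summable. -/
structure IsStepSize (lam : ℕ → ℝ) : Prop where
  antitone : Antitone lam
  sum_diverges : Tendsto (fun T => ∑ t ∈ Finset.range T, lam t) atTop atTop
  sq_summable : Summable fun t => lam t ^ 2

end CrashOpt

end

namespace CrashOpt

/-! ### Real sequences -/

/-! There are finitely many agents, so crashes eventually stop. From then on the non-faulty agents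
average with one fixed row stochastic matrix `A`, and the earlier iterations only change the
starting point.

The limit cost is `p = ∑ π i * h i`, with `π` a stationary distribution of `A` and weight zero on
faulty agents. A node `k` of the source component reaches everybody, so column `k` of a power of `A`
is bounded below (`pow_le_pow_card_apply`). Such a bound passes to `π k` (`le_stationary`), which
gives the `β`-bounds, and it makes that power contract the spread (`spread_mulVec_le`).

Contraction up to errors of order `lam t` makes the squared spreads summable (`summable_spread_sq`).
Hence `∑ π i * (x t i - z) ^ 2` decreases by `2 * lam t * (p (x t k) - p z)` up to a summable error.
For minimizers `z` of `p` it therefore converges (`quasi_descent`), and divergence of `∑ lam t`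
yields a cluster point that minimizes `p`. Taking `z` to be that point, the limit is zero. -/

theorem summable_of_delayed_contraction {u b : ℕ → ℝ} {q : ℝ} {m : ℕ} (hu : ∀ t, 0 ≤ u t)
    (hq : q < 1) (hb0 : ∀ t, 0 ≤ b t) (hb : Summable b)
    (hrec : ∀ t, u (t + m) ≤ q * u t + b t) : Summable u := by
  refine summable_of_sum_range_le
    (c := (∑ t ∈ Finset.range m, u t + ∑' t, b t) / (1 - q)) hu fun T => ?_
  have h1 : ∑ t ∈ Finset.range T, u t ≤ ∑ t ∈ Finset.range (m + T), u t :=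
    Finset.sum_le_sum_of_subset_of_nonneg (Finset.range_subset_range.2 (by omega))
      fun t _ _ => hu t
  rw [Finset.sum_range_add] at h1
  -- The summed recurrence bounds the partial sum by `q` times itself plus a constant; `q < 1` lets
  -- it be absorbed.
  have h2 : ∑ t ∈ Finset.range T, u (m + t) ≤
      q * ∑ t ∈ Finset.range T, u t + ∑ t ∈ Finset.range T, b t := by
    rw [Finset.mul_sum, ← Finset.sum_add_distrib]
    exact Finset.sum_le_sum fun t _ => by rw [add_comm m t]; exact hrec t
  have h3 : ∑ t ∈ Finset.range T, b t ≤ ∑' t, b t := hb.sum_le_tsum _ fun t _ => hb0 t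
  rw [le_div_iff₀ (by linarith)]
  linarith

/-- Subtracting the partial sums of `s` from `v` leaves a non-increasing sequence that is bounded
below. -/
theorem quasi_descent {v c s : ℕ → ℝ} (hv : ∀ t, 0 ≤ v t) (hc : ∀ t, 0 ≤ c t)
    (hs0 : ∀ t, 0 ≤ s t) (hs : Summable s) (hrec : ∀ t, v (t + 1) ≤ v t - c t + s t) :
    Summable c ∧ ∃ l, Tendsto v atTop (𝓝 l) := by
  have hsle : ∀ T, ∑ t ∈ Finset.range T, s t ≤ ∑' t, s t :=
    fun T => hs.sum_le_tsum _ fun t _ => hs0 t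
  constructor
  · refine summable_of_sum_range_le (c := v 0 + ∑' t, s t) hc fun T => ?_
    have key : ∀ T, v T + ∑ t ∈ Finset.range T, c t ≤ v 0 + ∑ t ∈ Finset.range T, s t := by
      intro T
      induction T with
      | zero => simp
      | succ T ih =>
        rw [Finset.sum_range_succ, Finset.sum_range_succ]
        linarith [hrec T]
    linarith [key T, hv T, hsle T]
  · have hanti : Antitone fun T => v T - ∑ t ∈ Finset.range T, s t := by
      refine antitone_nat_of_succ_le fun T => ?_
      rw [Finset.sum_range_succ]
      linarith [hrec T, hc T]
    have hbdd : BddBelow (Set.range fun T => v T - ∑ t ∈ Finset.range T, s t) := by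
      refine ⟨-∑' t, s t, ?_⟩
      rintro _ ⟨T, rfl⟩
      dsimp only
      linarith [hv T, hsle T]
    have h1 := tendsto_atTop_ciInf hanti hbdd
    have h2 := h1.add hs.hasSum.tendsto_sum_nat
    exact ⟨_, by simpa using h2⟩

/-- Otherwise `lam t ≤ ε⁻¹ * (lam t * f t)` eventually, and `lam` would be summable. -/
theorem frequently_lt_of_summable_mul {lam f : ℕ → ℝ} (hlam : ∀ t, 0 ≤ lam t)
    (hdiv : Tendsto (fun T => ∑ t ∈ Finset.range T, lam t) atTop atTop)
    (hsum : Summable fun t => lam t * f t) {ε : ℝ} (hε : 0 < ε) :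
    ∃ᶠ t in atTop, f t < ε := by
  intro hev
  obtain ⟨T, hT⟩ := eventually_atTop.1 hev
  have hsumm : Summable lam := by
    rw [← summable_nat_add_iff T]
    refine Summable.of_nonneg_of_le (fun t => hlam _) (fun t => ?_)
      (((summable_nat_add_iff T).2 hsum).mul_left ε⁻¹)
    have h1 : ε ≤ f (t + T) := not_lt.1 (hT (t + T) (by omega))
    have h2 := mul_le_mul_of_nonneg_left h1 (hlam (t + T))
    rw [inv_mul_eq_div, le_div_iff₀ hε]
    exact h2
  exact not_tendsto_nhds_of_tendsto_atTop hdiv _ hsumm.hasSum.tendsto_sum_nat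

theorem IsStepSize.tendsto_zero {lam : ℕ → ℝ} (hlam : IsStepSize lam) :
    Tendsto lam atTop (𝓝 0) := by
  have h := hlam.sq_summable.tendsto_atTop_zero
  have h2 := (Real.continuous_sqrt.tendsto 0).comp h
  simp only [Real.sqrt_zero] at h2
  refine (tendsto_zero_iff_abs_tendsto_zero _).2 (h2.congr fun t => ?_)
  simp [Real.sqrt_sq_eq_abs]

theorem IsStepSize.nonneg {lam : ℕ → ℝ} (hlam : IsStepSize lam) (t : ℕ) : 0 ≤ lam t :=
  hlam.antitone.le_of_tendsto hlam.tendsto_zero t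

theorem IsStepSize.shift {lam : ℕ → ℝ} (hlam : IsStepSize lam) (k : ℕ) :
    IsStepSize fun t => lam (k + t) where
  antitone := fun _ _ hst => hlam.antitone (by omega)
  sum_diverges := by
    have h1 := (tendsto_add_atTop_iff_nat k).2 hlam.sum_diverges
    have h2 := tendsto_atTop_add_const_right _ (-∑ t ∈ Finset.range k, lam t) h1
    refine h2.congr fun T => ?_
    rw [add_comm T k, Finset.sum_range_add]
    ring
  sq_summable := by
    have := (summable_nat_add_iff k).2 hlam.sq_summable
    simpa only [add_comm] using this

/-! ### Projections and cost functions on the line -/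

theorem sq_sub_le_of_mem_argminOn {X : Set ℝ} (hX : Convex ℝ X) {u w z : ℝ}
    (hu : u ∈ argminOn X fun y => |y - w|) (hz : z ∈ X) : (u - z) ^ 2 ≤ (w - z) ^ 2 := by
  obtain ⟨huX, hmin⟩ := hu
  -- Obtuse angle property: if `z` and `w` lay strictly on the same side of `u`, the nearer of them
  -- to `u` would be feasible and closer to `w`.
  have key : (w - u) * (z - u) ≤ 0 := by
    by_contra! hpos
    rcases pos_and_pos_or_neg_and_neg_of_mul_pos hpos with ⟨h1, h2⟩ | ⟨h1, h2⟩
    · have hm : min z w ∈ X := hX.ordConnected.out huX hz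
        ⟨le_min (by linarith) (by linarith), min_le_left _ _⟩
      have h3 := hmin _ hm
      have h4 : u < min z w := lt_min (by linarith) (by linarith)
      have h5 := min_le_right z w
      dsimp only at h3
      rw [abs_of_nonpos (by linarith), abs_of_nonpos (by linarith)] at h3
      linarith
    · have hm : max z w ∈ X := hX.ordConnected.out hz huX
        ⟨le_max_left _ _, max_le (by linarith) (by linarith)⟩
      have h3 := hmin _ hm
      have h4 : max z w < u := max_lt (by linarith) (by linarith)
      have h5 := le_max_right z w
      dsimp only at h3
      rw [abs_of_nonneg (by linarith), abs_of_nonneg (by linarith)] at h3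
      linarith
  nlinarith [sq_nonneg (w - u)]

theorem Admissible.subgradient {X : Set ℝ} {L : ℝ} {h h' : ℝ → ℝ} (H : Admissible X L h h')
    {x y : ℝ} (hx : x ∈ X) (hy : y ∈ X) : h x + h' x * (y - x) ≤ h y := by
  rcases lt_trichotomy x y with hxy | rfl | hxy
  · have := H.convex.le_slope_of_hasDerivWithinAt hx hy hxy (H.hasDeriv x hx)
    rw [slope_def_field, le_div_iff₀ (by linarith)] at this
    linarith
  · simp
  · have := H.convex.slope_le_of_hasDerivWithinAt hy hx hxy (H.hasDeriv x hx)
    rw [slope_def_field, div_le_iff₀ (by linarith)] at this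
    linarith

theorem Admissible.continuousOn {X : Set ℝ} {L : ℝ} {h h' : ℝ → ℝ} (H : Admissible X L h h') :
    ContinuousOn h X := fun x hx => (H.hasDeriv x hx).continuousWithinAt

theorem Admissible.le_of_argmin_le {X : Set ℝ} {L : ℝ} {h h' : ℝ → ℝ} (H : Admissible X L h h')
    {m x y : ℝ} (hm : m ∈ argminOn X h) (hy : y ∈ X)
    (hxy : m ≤ x ∧ x ≤ y ∨ y ≤ x ∧ x ≤ m) : h x ≤ h y := by
  have hseg : x ∈ segment ℝ m y := by
    rcases hxy with hxy | hxy
    · rwa [segment_eq_Icc (hxy.1.trans hxy.2)]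
    · rw [segment_symm, segment_eq_Icc (hxy.1.trans hxy.2)]
      exact hxy
  exact (H.convex.le_on_segment hm.1 hy hseg).trans (max_le (hm.2 y hy) le_rfl)

theorem argminOn_weighted_sum_nonempty {W : Type*} [Fintype W] [Nonempty W] {X : Set ℝ}
    (hXcl : IsClosed X) {L : ℝ} {h h' : W → ℝ → ℝ}
    (H : ∀ i, Admissible X L (h i) (h' i)) {w : W → ℝ} (hw : ∀ i, 0 ≤ w i) :
    (argminOn X fun x => ∑ i, w i * h i x).Nonempty := by
  choose m hm using fun i => (H i).argmin_nonempty
  obtain ⟨a, ha⟩ := Finite.exists_min m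
  obtain ⟨b, hb⟩ := Finite.exists_max m
  have hcont : ContinuousOn (fun x => ∑ i, w i * h i x) (Set.Icc (m a) (m b) ∩ X) :=
    continuousOn_finsetSum _ fun i _ =>
      continuousOn_const.mul ((H i).continuousOn.mono Set.inter_subset_right)
  obtain ⟨z, hz, hzmin⟩ := (isCompact_Icc.inter_right hXcl).exists_isMinOn
    ⟨m a, ⟨le_rfl, ha b⟩, (hm a).1⟩ hcont
  refine ⟨z, hz.2, fun y hy => ?_⟩
  -- Clamping `y` to the hull of the chosen minimizers moves it towards all of them, so no `h i`
  -- increases.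
  suffices hc : ∃ c ∈ Set.Icc (m a) (m b) ∩ X, ∀ i, h i c ≤ h i y by
    obtain ⟨c, hc, hcy⟩ := hc
    exact (hzmin hc).trans
      (Finset.sum_le_sum fun i _ => mul_le_mul_of_nonneg_left (hcy i) (hw i))
  rcases le_total y (m a) with hya | hya
  · exact ⟨m a, ⟨⟨le_rfl, ha b⟩, (hm a).1⟩, fun i =>
      (H i).le_of_argmin_le (hm i) hy (Or.inr ⟨hya, ha i⟩)⟩
  rcases le_total y (m b) with hyb | hyb
  · exact ⟨y, ⟨⟨hya, hyb⟩, hy⟩, fun _ => le_rfl⟩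
  · exact ⟨m b, ⟨⟨ha b, le_rfl⟩, (hm b).1⟩, fun i =>
      (H i).le_of_argmin_le (hm i) hy (Or.inl ⟨hb i, hyb⟩)⟩

/-! ### Spread of a vector -/

section Spread

variable {W : Type*} [Fintype W]

/-- The largest difference between two coordinates. -/
def spread [Nonempty W] (x : W → ℝ) : ℝ :=
  Finset.univ.sup' Finset.univ_nonempty fun p : W × W => x p.1 - x p.2

theorem sub_le_spread [Nonempty W] (x : W → ℝ) (i j : W) : x i - x j ≤ spread x :=
  Finset.le_sup' (fun p : W × W => x p.1 - x p.2) (Finset.mem_univ (i, j))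

theorem abs_sub_le_spread [Nonempty W] (x : W → ℝ) (i j : W) : |x i - x j| ≤ spread x :=
  abs_sub_le_iff.2 ⟨sub_le_spread x i j, sub_le_spread x j i⟩

theorem spread_le [Nonempty W] {x : W → ℝ} {c : ℝ} (h : ∀ i j, x i - x j ≤ c) : spread x ≤ c :=
  Finset.sup'_le _ _ fun p _ => h p.1 p.2

theorem spread_nonneg [Nonempty W] (x : W → ℝ) : 0 ≤ spread x := by
  obtain ⟨i⟩ := ‹Nonempty W›
  simpa using sub_le_spread x i i

theorem spread_le_add [Nonempty W] {x y : W → ℝ} {c : ℝ} (h : ∀ i, |x i - y i| ≤ c) :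
    spread x ≤ spread y + 2 * c := by
  refine spread_le fun i j => ?_
  have h1 := abs_le.1 (h i)
  have h2 := abs_le.1 (h j)
  linarith [sub_le_spread y i j]

end Spread

/-! ### Row stochastic matrices -/

section Stochastic

open Matrix

variable {W : Type*} [Fintype W] [DecidableEq W] {A : Matrix W W ℝ}

theorem mulVec_mem_of_mem_rowStochastic (hA : A ∈ rowStochastic ℝ W) {X : Set ℝ}
    (hX : Convex ℝ X) {x : W → ℝ} (hx : ∀ i, x i ∈ X) (i : W) : (A *ᵥ x) i ∈ X :=
  hX.sum_mem (fun j _ => hA.1 i j) (sum_row_of_mem_rowStochastic hA i) fun j _ => hx j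

theorem mulVec_sub_const (hA : A ∈ rowStochastic ℝ W) (x : W → ℝ) (c : ℝ) (i : W) :
    (A *ᵥ x) i - c = ∑ j, A i j * (x j - c) := by
  simp only [mulVec, dotProduct, mul_sub, Finset.sum_sub_distrib, ← Finset.sum_mul,
    sum_row_of_mem_rowStochastic hA i, one_mul]

theorem abs_mulVec_le (hA : A ∈ rowStochastic ℝ W) {v : W → ℝ} {c : ℝ} (hv : ∀ j, |v j| ≤ c)
    (i : W) : |(A *ᵥ v) i| ≤ c := by
  have h := mulVec_mem_of_mem_rowStochastic hA (convex_Icc (-c) c)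
    (fun j => abs_le.1 (hv j)) i
  exact abs_le.2 h

theorem sq_mulVec_sub_le (hA : A ∈ rowStochastic ℝ W) (x : W → ℝ) (c : ℝ) (i : W) :
    ((A *ᵥ x) i - c) ^ 2 ≤ ∑ j, A i j * (x j - c) ^ 2 := by
  rw [mulVec_sub_const hA]
  have h := (Even.convexOn_pow (𝕜 := ℝ) even_two).map_sum_le (t := Finset.univ) (w := A i)
    (p := fun j => x j - c) (fun j _ => hA.1 i j) (sum_row_of_mem_rowStochastic hA i)
    fun _ _ => Set.mem_univ _
  simpa only [smul_eq_mul] using h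

theorem mulVec_le_of_column_ge (hA : A ∈ rowStochastic ℝ W) {k i : W} {δ : ℝ} (hδ : δ ≤ A i k)
    {x : W → ℝ} {M : ℝ} (hM : ∀ j, x j ≤ M) : (A *ᵥ x) i ≤ M - δ * (M - x k) := by
  have h1 := mulVec_sub_const hA x M i
  have h2 : ∑ j, A i j * (x j - M) ≤ A i k * (x k - M) := by
    rw [← Finset.add_sum_erase _ _ (Finset.mem_univ k)]
    have : ∑ j ∈ Finset.univ.erase k, A i j * (x j - M) ≤ 0 :=
      Finset.sum_nonpos fun j _ =>
        mul_nonpos_of_nonneg_of_nonpos (hA.1 i j) (sub_nonpos.2 (hM j))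
    linarith
  have h3 := mul_le_mul_of_nonneg_right hδ (sub_nonneg.2 (hM k))
  linarith

/-- Doeblin's argument: every row puts mass at least `δ` on the same coordinate `k`, and this common
part cancels in differences. -/
theorem spread_mulVec_le [Nonempty W] (hA : A ∈ rowStochastic ℝ W) {k : W} {δ : ℝ}
    (hδ : ∀ i, δ ≤ A i k) (hδ1 : δ ≤ 1) (x : W → ℝ) :
    spread (A *ᵥ x) ≤ (1 - δ) * spread x := by
  obtain ⟨a, ha⟩ := Finite.exists_max x
  obtain ⟨b, hb⟩ := Finite.exists_min x
  refine spread_le fun i j => ?_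
  have h1 := mulVec_le_of_column_ge hA (hδ i) ha
  have h2 := mulVec_le_of_column_ge hA (hδ j) (x := -x) (M := -x b) fun l => neg_le_neg (hb l)
  rw [mulVec_neg, Pi.neg_apply, Pi.neg_apply] at h2
  have h3 := mul_le_mul_of_nonneg_left (sub_le_spread x a b) (sub_nonneg.2 hδ1)
  linarith

/-- Averaging does not enlarge errors, so `m` perturbations, each at most `ε t`, simply add up. -/
theorem abs_sub_pow_mulVec_le (hA : A ∈ rowStochastic ℝ W) {x : ℕ → W → ℝ} {ε : ℕ → ℝ}
    (hε : Antitone ε) (hx : ∀ t i, |x (t + 1) i - (A *ᵥ x t) i| ≤ ε t) (t m : ℕ) (i : W) :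
    |x (t + m) i - (A ^ m *ᵥ x t) i| ≤ m * ε t := by
  induction m generalizing i with
  | zero => simp
  | succ m ih =>
    have h1 := (hx (t + m) i).trans (hε (Nat.le_add_right t m))
    have h2 := abs_mulVec_le hA (v := x (t + m) - A ^ m *ᵥ x t) (c := m * ε t) ih i
    rw [mulVec_sub, mulVec_mulVec, ← pow_succ', Pi.sub_apply] at h2
    have h3 := abs_sub_le (x (t + (m + 1)) i) ((A *ᵥ x (t + m)) i) ((A ^ (m + 1) *ᵥ x t) i)
    rw [← add_assoc] at h3 ⊢
    push_cast
    linarith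

theorem summable_spread_sq [Nonempty W] (hA : A ∈ rowStochastic ℝ W) {k : W} {m : ℕ} {δ : ℝ}
    (hδ0 : 0 < δ) (hδ : ∀ i, δ ≤ (A ^ m) i k) {x : ℕ → W → ℝ} {ε : ℕ → ℝ}
    (hε : Antitone ε) (hεsq : Summable fun t => ε t ^ 2)
    (hx : ∀ t i, |x (t + 1) i - (A *ᵥ x t) i| ≤ ε t) :
    Summable fun t => spread (x t) ^ 2 := by
  have hAm := pow_mem hA m
  have hδ1 : δ ≤ 1 := (hδ k).trans (le_one_of_mem_rowStochastic hAm)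
  have hε0 : ∀ t, 0 ≤ ε t := fun t => (abs_nonneg _).trans (hx t k)
  refine summable_of_delayed_contraction (q := 1 - δ) (m := m)
    (b := fun t => (2 * m) ^ 2 / δ * ε t ^ 2) (fun t => sq_nonneg _) (by linarith)
    (fun t => by positivity) (hεsq.mul_left _) fun t => ?_
  have h1 := spread_le_add (abs_sub_pow_mulVec_le hA hε hx t m)
  have h2 := h1.trans (add_le_add_left (spread_mulVec_le hAm hδ hδ1 (x t)) _)
  have h3 := pow_le_pow_left₀ (spread_nonneg _) h2 2
  refine h3.trans ?_
  set D := spread (x t)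
  -- Convexity of the square for the mixture of `D` and `2 * m * ε t / δ` with weights `1 - δ` and
  -- `δ`; the gap is an explicit square.
  have key : (1 - δ) * D ^ 2 + (2 * m) ^ 2 / δ * ε t ^ 2
      - ((1 - δ) * D + 2 * (m * ε t)) ^ 2
      = (1 - δ) / δ * (δ * D - 2 * m * ε t) ^ 2 := by
    field_simp
    ring
  have : 0 ≤ (1 - δ) / δ * (δ * D - 2 * m * ε t) ^ 2 :=
    mul_nonneg (div_nonneg (by linarith) hδ0.le) (sq_nonneg _)
  linarith

/-- The constant vector makes `1 - A` singular, so there is a left fixed vector `v`. Entrywise `|v|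
≤ |v| A` with equal totals, so `|v|` is fixed as well; normalize it. -/
theorem exists_stationary [Nonempty W] (hA : A ∈ rowStochastic ℝ W) :
    ∃ π : W → ℝ, (∀ i, 0 ≤ π i) ∧ ∑ i, π i = 1 ∧ π ᵥ* A = π := by
  have hdet : (1 - A).det = 0 := by
    refine exists_mulVec_eq_zero_iff.1 ⟨1, one_ne_zero, ?_⟩
    rw [sub_mulVec, one_mulVec, hA.2, sub_self]
  obtain ⟨v, hv0, hv⟩ := exists_vecMul_eq_zero_iff.2 hdet
  rw [vecMul_sub, vecMul_one, sub_eq_zero] at hv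
  have hle : ∀ j ∈ Finset.univ, |v j| ≤ ∑ i, |v i| * A i j := fun j _ => by
    calc |v j| = |∑ i, v i * A i j| := congrArg abs (congrFun hv j)
      _ ≤ ∑ i, |v i * A i j| := Finset.abs_sum_le_sum_abs _ _
      _ = ∑ i, |v i| * A i j :=
        Finset.sum_congr rfl fun i _ => by rw [abs_mul, abs_of_nonneg (hA.1 i j)]
  have hsum : ∑ j, |v j| = ∑ j, ∑ i, |v i| * A i j := by
    rw [Finset.sum_comm]
    refine Finset.sum_congr rfl fun i _ => ?_
    rw [← Finset.mul_sum, sum_row_of_mem_rowStochastic hA i, mul_one]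
  have heq := (Finset.sum_eq_sum_iff_of_le hle).1 hsum
  have hpos : 0 < ∑ i, |v i| := by
    obtain ⟨i, hi⟩ := Function.ne_iff.1 hv0
    exact Finset.sum_pos' (fun i _ => abs_nonneg _) ⟨i, Finset.mem_univ _, abs_pos.2 hi⟩
  refine ⟨fun i => |v i| / ∑ i, |v i|, fun i => by positivity, ?_, funext fun j => ?_⟩
  · rw [← Finset.sum_div, div_self hpos.ne']
  · change ∑ i, |v i| / (∑ i, |v i|) * A i j = |v j| / ∑ i, |v i|
    rw [heq j (Finset.mem_univ j), Finset.sum_div]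
    exact Finset.sum_congr rfl fun i _ => by ring

theorem vecMul_pow_of_stationary {π : W → ℝ} (hπ : π ᵥ* A = π) (m : ℕ) : π ᵥ* A ^ m = π := by
  induction m with
  | zero => simp
  | succ m ih => rw [pow_succ, ← vecMul_vecMul, ih, hπ]

theorem le_stationary {π : W → ℝ} (hπ0 : ∀ i, 0 ≤ π i) (hπ1 : ∑ i, π i = 1)
    (hπ : π ᵥ* A = π) {m : ℕ} {k : W} {δ : ℝ} (hδ : ∀ i, δ ≤ (A ^ m) i k) : δ ≤ π k := by
  rw [← vecMul_pow_of_stationary hπ m]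
  calc δ = ∑ i, π i * δ := by rw [← Finset.sum_mul, hπ1, one_mul]
    _ ≤ ∑ i, π i * (A ^ m) i k :=
      Finset.sum_le_sum fun i _ => mul_le_mul_of_nonneg_left (hδ i) (hπ0 i)

/-- If every node is reachable from `k` along positive entries of `A`, all of them at least `c`,
then column `k` of `A ^ |W|` is at least `c ^ |W|`. -/
theorem pow_le_pow_card_apply (hA : A ∈ rowStochastic ℝ W) {c : ℝ} (hc : 0 ≤ c)
    (hdiag : ∀ i, c ≤ A i i) {k : W}
    (hreach : ∀ B : Finset W, k ∈ B → (∀ i ∈ B, ∀ j, c ≤ A j i → j ∈ B) → B = Finset.univ)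
    (i : W) : c ^ Fintype.card W ≤ (A ^ Fintype.card W) i k := by
  classical
  -- `B` gains a node at each step until it is everything; at `m = |W|` the alternative `m + 1 ≤
  -- B.card` is impossible.
  have hpow : ∀ m, ∃ B : Finset W, k ∈ B ∧ (∀ i ∈ B, c ^ m ≤ (A ^ m) i k) ∧
      (B = Finset.univ ∨ m + 1 ≤ B.card) := by
    intro m
    induction m with
    | zero => exact ⟨{k}, by simp, by simp, by simp⟩
    | succ m ih =>
      obtain ⟨B, hkB, hB, hcard⟩ := ih
      have hstep : ∀ i ∈ B, ∀ j, c ≤ A j i → c ^ (m + 1) ≤ (A ^ (m + 1)) j k := by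
        intro i hi j hj
        rw [pow_succ', pow_succ', mul_apply]
        calc c * c ^ m ≤ A j i * (A ^ m) i k :=
              mul_le_mul hj (hB i hi) (pow_nonneg hc m) (hA.1 j i)
          _ ≤ ∑ l, A j l * (A ^ m) l k :=
              Finset.single_le_sum (f := fun l => A j l * (A ^ m) l k)
                (fun l _ => mul_nonneg (hA.1 j l) ((pow_mem hA m).1 l k)) (Finset.mem_univ i)
      let B' : Finset W := {j | ∃ i ∈ B, c ≤ A j i}
      have hsub : B ⊆ B' := fun i hi => by
        simpa [B'] using ⟨i, hi, hdiag i⟩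
      refine ⟨B', hsub hkB, fun j hj => ?_, ?_⟩
      · obtain ⟨i, hi, hji⟩ := by simpa [B'] using hj
        exact hstep i hi j hji
      · rcases hcard with rfl | hcard
        · exact Or.inl (Finset.univ_subset_iff.1 hsub)
        rcases hsub.eq_or_ssubset with heq | hss
        · left
          rw [← heq]
          refine hreach B hkB fun i hi j hj => ?_
          rw [heq]
          simpa [B'] using ⟨i, hi, hj⟩
        · right
          have := Finset.card_lt_card hss
          omega
  obtain ⟨B, -, hB, hcard⟩ := hpow (Fintype.card W)
  refine hB i ?_
  rcases hcard with rfl | hcard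
  · exact Finset.mem_univ i
  · have := B.card_le_univ
    omega

end Stochastic

/-! ### Projected gradient consensus with a fixed matrix -/

section Consensus

open Matrix

variable {W : Type*} [Fintype W] [DecidableEq W]

/-- The projected gradient step of all agents, with mixing matrix `A` and all estimates in `X`. -/
structure IsConsensusIteration (A : Matrix W W ℝ) (X : Set ℝ) (h' : W → ℝ → ℝ) (lam : ℕ → ℝ)
    (x : ℕ → W → ℝ) : Prop where
  mem : ∀ t i, x t i ∈ X
  update : ∀ t i, x (t + 1) i ∈ argminOn X fun z => |z - ((A *ᵥ x t) i - lam t * h' i (x t i))|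

variable {A : Matrix W W ℝ} {X : Set ℝ} {L : ℝ} {h h' : W → ℝ → ℝ} {lam : ℕ → ℝ}
  {x : ℕ → W → ℝ}

theorem IsConsensusIteration.abs_sub_mulVec_le (hx : IsConsensusIteration A X h' lam x)
    (hA : A ∈ rowStochastic ℝ W) (hX : Convex ℝ X) (H : ∀ i, Admissible X L (h i) (h' i))
    (hlam : ∀ t, 0 ≤ lam t) (t : ℕ) (i : W) : |x (t + 1) i - (A *ᵥ x t) i| ≤ L * lam t := by
  have h1 := sq_sub_le_of_mem_argminOn hX (hx.update t i)
    (mulVec_mem_of_mem_rowStochastic hA hX (hx.mem t) i)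
  rw [sub_sub_cancel_left, neg_sq] at h1
  refine (sq_le_sq.1 h1).trans ?_
  rw [abs_mul, abs_of_nonneg (hlam t), mul_comm]
  exact mul_le_mul_of_nonneg_right ((H i).bounded_deriv _ (hx.mem t i)) (hlam t)

theorem abs_mulVec_sub_le_spread [Nonempty W] (hA : A ∈ rowStochastic ℝ W) (y : W → ℝ) (i : W) :
    |(A *ᵥ y) i - y i| ≤ spread y := by
  have h1 := abs_mulVec_le hA (v := fun j => y j - y i) (fun j => abs_sub_le_spread y j i) i
  rw [mulVec_sub_const hA]
  exact h1

/-- All costs are evaluated at one reference agent `k`, so that weighting by `π` produces `p (x t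
k)`. Replacing the average by `x t i`, and then `x t i` by `x t k`, costs `L * spread` each; the
factor `2 * lam t` turns this into the `4 * L` term. -/
theorem IsConsensusIteration.sq_sub_le [Nonempty W] (hx : IsConsensusIteration A X h' lam x)
    (hA : A ∈ rowStochastic ℝ W) (hX : Convex ℝ X) (H : ∀ i, Admissible X L (h i) (h' i))
    (hL : 0 ≤ L) (hlam : ∀ t, 0 ≤ lam t) {z : ℝ} (hz : z ∈ X) (k : W) (t : ℕ) (i : W) :
    (x (t + 1) i - z) ^ 2 ≤ ∑ j, A i j * (x t j - z) ^ 2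
      - 2 * lam t * (h i (x t k) - h i z) + 4 * L * (lam t * spread (x t))
      + L ^ 2 * lam t ^ 2 := by
  have h1 := sq_sub_le_of_mem_argminOn hX (hx.update t i) hz
  have h2 := sq_mulVec_sub_le hA (x t) z i
  have h3 := (H i).subgradient (hx.mem t i) hz
  have h4 := (H i).subgradient (hx.mem t k) (hx.mem t i)
  set g := h' i (x t i)
  set a := (A *ᵥ x t) i
  have hg : |g| ≤ L := (H i).bounded_deriv _ (hx.mem t i)
  have h5 : |g * (a - x t i)| ≤ L * spread (x t) := by
    rw [abs_mul]
    exact mul_le_mul hg (abs_mulVec_sub_le_spread hA (x t) i) (abs_nonneg _) hL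
  have h6 : |h' i (x t k) * (x t i - x t k)| ≤ L * spread (x t) := by
    rw [abs_mul]
    exact mul_le_mul ((H i).bounded_deriv _ (hx.mem t k)) (abs_sub_le_spread (x t) i k)
      (abs_nonneg _) hL
  have h7 : g ^ 2 ≤ L ^ 2 := sq_le_sq.2 (hg.trans (le_abs_self L))
  have h8 := mul_le_mul_of_nonneg_left h7 (sq_nonneg (lam t))
  have h9 : h i (x t k) - h i z - 2 * (L * spread (x t)) ≤ g * (a - z) := by
    linarith [(abs_le.1 h5).1, (abs_le.1 h6).1]
  have h10 := mul_le_mul_of_nonneg_left h9 (hlam t)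
  nlinarith

theorem IsConsensusIteration.exists_limit [Nonempty W] (hx : IsConsensusIteration A X h' lam x)
    (hA : A ∈ rowStochastic ℝ W) (hXcl : IsClosed X) (hX : Convex ℝ X)
    (H : ∀ i, Admissible X L (h i) (h' i)) (hlam : IsStepSize lam)
    {π : W → ℝ} (hπ0 : ∀ i, 0 ≤ π i) (hπ1 : ∑ i, π i = 1) (hπ : π ᵥ* A = π)
    {k : W} {m : ℕ} {δ : ℝ} (hδ0 : 0 < δ) (hδ : ∀ i, δ ≤ (A ^ m) i k) :
    ∃ z ∈ argminOn X fun y => ∑ i, π i * h i y,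
      ∀ i, Tendsto (fun t => x t i) atTop (𝓝 z) := by
  have hl0 := hlam.nonneg
  have hL : 0 ≤ L := (abs_nonneg _).trans ((H k).bounded_deriv _ (hx.mem 0 k))
  set p : ℝ → ℝ := fun y => ∑ i, π i * h i y with hp
  have hπk : 0 < π k := hδ0.trans_le (le_stationary hπ0 hπ1 hπ hδ)
  have hD2 : Summable fun t => spread (x t) ^ 2 :=
    summable_spread_sq hA hδ0 hδ (ε := fun t => L * lam t)
      (fun s t hst => mul_le_mul_of_nonneg_left (hlam.antitone hst) hL)
      ((hlam.sq_summable.mul_left (L ^ 2)).congr fun t => by ring)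
      (hx.abs_sub_mulVec_le hA hX H hl0)
  have hD0 : Tendsto (fun t => spread (x t)) atTop (𝓝 0) := by
    have h2 := (Real.continuous_sqrt.tendsto 0).comp hD2.tendsto_atTop_zero
    rw [Real.sqrt_zero] at h2
    exact h2.congr fun t => Real.sqrt_sq (spread_nonneg _)
  have hlD : Summable fun t => lam t * spread (x t) := by
    refine Summable.of_nonneg_of_le (fun t => mul_nonneg (hl0 t) (spread_nonneg _)) (fun t => ?_)
      (hlam.sq_summable.add hD2)
    nlinarith [sq_nonneg (lam t - spread (x t)), sq_nonneg (lam t), sq_nonneg (spread (x t))]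
  let v : ℝ → ℕ → ℝ := fun z t => ∑ i, π i * (x t i - z) ^ 2
  have hv0 : ∀ z t, 0 ≤ v z t := fun z t =>
    Finset.sum_nonneg fun i _ => mul_nonneg (hπ0 i) (sq_nonneg _)
  have hvk : ∀ z t, (x t k - z) ^ 2 ≤ v z t / π k := fun z t => by
    rw [le_div_iff₀ hπk, mul_comm]
    exact Finset.single_le_sum (f := fun i => π i * (x t i - z) ^ 2)
      (fun i _ => mul_nonneg (hπ0 i) (sq_nonneg _)) (Finset.mem_univ k)
  have hdesc : ∀ z ∈ X, ∀ t, v z (t + 1) ≤ v z t - 2 * (lam t * (p (x t k) - p z))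
      + (4 * L * (lam t * spread (x t)) + L ^ 2 * lam t ^ 2) := by
    intro z hz t
    -- Stationarity of `π` is what makes the mixing step neutral for `v`.
    have hmix : ∑ i, π i * ∑ j, A i j * (x t j - z) ^ 2 = v z t := by
      have := dotProduct_mulVec π A fun j => (x t j - z) ^ 2
      rw [hπ] at this
      exact this
    calc v z (t + 1) ≤ ∑ i, π i * (∑ j, A i j * (x t j - z) ^ 2
          - 2 * lam t * (h i (x t k) - h i z) + 4 * L * (lam t * spread (x t))
          + L ^ 2 * lam t ^ 2) :=
          Finset.sum_le_sum fun i _ => mul_le_mul_of_nonneg_left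
            (hx.sq_sub_le hA hX H hL hl0 hz k t i) (hπ0 i)
      _ = ∑ i, π i * ∑ j, A i j * (x t j - z) ^ 2
          - 2 * (lam t * (p (x t k) - p z))
          + (∑ i, π i) * (4 * L * (lam t * spread (x t)) + L ^ 2 * lam t ^ 2) := by
        simp only [hp, Finset.mul_sum, Finset.sum_mul, ← Finset.sum_sub_distrib,
          ← Finset.sum_add_distrib]
        refine Finset.sum_congr rfl fun i _ => ?_
        rw [← Finset.mul_sum]
        ring
      _ = _ := by rw [hmix, hπ1, one_mul]
  have hfejer : ∀ z ∈ argminOn X p,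
      (Summable fun t => 2 * (lam t * (p (x t k) - p z))) ∧ ∃ l, Tendsto (v z) atTop (𝓝 l) :=
    fun z hz => quasi_descent (hv0 z)
      (fun t => mul_nonneg zero_le_two
        (mul_nonneg (hl0 t) (sub_nonneg.2 (hz.2 _ (hx.mem t k)))))
      (fun t => add_nonneg (mul_nonneg (by positivity) (mul_nonneg (hl0 t) (spread_nonneg _)))
        (by positivity))
      ((hlD.mul_left _).add (hlam.sq_summable.mul_left _)) (hdesc z hz.1)
  obtain ⟨z₀, hz₀⟩ : (argminOn X p).Nonempty := argminOn_weighted_sum_nonempty hXcl H hπ0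
  obtain ⟨hsum, l₀, hl₀⟩ := hfejer z₀ hz₀
  have hsum' : Summable fun t => lam t * (p (x t k) - p z₀) :=
    (summable_mul_left_iff two_ne_zero).1 hsum
  obtain ⟨φ, hφ, hφlt⟩ := extraction_forall_of_frequently fun n : ℕ =>
    frequently_lt_of_summable_mul hl0 hlam.sum_diverges hsum' (Nat.one_div_pos_of_nat (n := n))
  have hpφ : Tendsto (fun n => p (x (φ n) k)) atTop (𝓝 (p z₀)) := by
    have hup : Tendsto (fun n : ℕ => p z₀ + 1 / ((n : ℝ) + 1)) atTop (𝓝 (p z₀)) := by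
      simpa using tendsto_one_div_add_atTop_nhds_zero_nat.const_add (p z₀)
    exact tendsto_of_tendsto_of_tendsto_of_le_of_le tendsto_const_nhds hup
      (fun n => hz₀.2 _ (hx.mem _ k)) fun n => by have := hφlt n; dsimp only at this ⊢; linarith
  obtain ⟨M, hM⟩ := hl₀.bddAbove_range
  have hbdd : ∀ t, x t k ∈ Metric.closedBall z₀ (Real.sqrt (M / π k)) := fun t => by
    rw [Metric.mem_closedBall, Real.dist_eq]
    refine Real.abs_le_sqrt ((hvk z₀ t).trans ?_)
    exact div_le_div_of_nonneg_right (hM ⟨t, rfl⟩) hπk.le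
  obtain ⟨z, -, ψ, hψ, hzlim⟩ :=
    tendsto_subseq_of_bounded Metric.isBounded_closedBall fun n => hbdd (φ n)
  have hzX : z ∈ X := hXcl.mem_of_tendsto hzlim (Eventually.of_forall fun n => hx.mem _ k)
  have hpc : ContinuousOn p X :=
    continuousOn_finsetSum _ fun i _ => continuousOn_const.mul (H i).continuousOn
  have hpz : p z = p z₀ :=
    tendsto_nhds_unique ((hpc z hzX).tendsto.comp (tendsto_nhdsWithin_iff.2
      ⟨hzlim, Eventually.of_forall fun n => hx.mem _ k⟩)) (hpφ.comp hψ.tendsto_atTop)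
  have hz : z ∈ argminOn X p := ⟨hzX, fun y hy => hpz.le.trans (hz₀.2 y hy)⟩
  obtain ⟨-, l, hl⟩ := hfejer z hz
  have hclose : ∀ i, Tendsto (fun t => x t i - x t k) atTop (𝓝 0) := fun i =>
    squeeze_zero_norm (fun t => abs_sub_le_spread (x t) i k) hD0
  have hsub : Tendsto (fun n => φ (ψ n)) atTop atTop := hφ.tendsto_atTop.comp hψ.tendsto_atTop
  -- `v z` converges along the whole sequence, and along the subsequence its limit is zero.
  have hl0' : l = 0 := by
    refine tendsto_nhds_unique (hl.comp hsub) ?_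
    have hi : ∀ i, Tendsto (fun n => x (φ (ψ n)) i) atTop (𝓝 z) := fun i => by
      have := ((hclose i).comp hsub).add hzlim
      rw [zero_add] at this
      exact this.congr fun n => sub_add_cancel _ _
    have := tendsto_finsetSum Finset.univ fun i _ =>
      (((hi i).sub_const z).pow 2).const_mul (π i)
    simpa [v, Function.comp_def] using this
  have hk : Tendsto (fun t => x t k) atTop (𝓝 z) := by
    have h1 : Tendsto (fun t => (x t k - z) ^ 2) atTop (𝓝 0) := by
      refine squeeze_zero (fun t => sq_nonneg _) (hvk z) ?_
      simpa [hl0'] using hl.div_const (π k)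
    have h2 := (Real.continuous_sqrt.tendsto 0).comp h1
    rw [Real.sqrt_zero] at h2
    rw [tendsto_iff_norm_sub_tendsto_zero]
    exact h2.congr fun t => Real.sqrt_sq_eq_abs _
  refine ⟨z, hz, fun i => ?_⟩
  have := (hclose i).add hk
  rw [zero_add] at this
  exact this.congr fun n => sub_add_cancel _ _

end Consensus

/-! ### Crash patterns -/

section Crash

variable {V : Type*} {G : Digraph V}

theorem CrashPattern.alive_antitone (C : CrashPattern G) : Antitone C.alive :=
  antitone_nat_of_succ_le C.alive_succ

theorem CrashPattern.mem_alive_of_mem_nonfaulty (C : CrashPattern G) {i : V}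
    (hi : i ∈ C.nonfaulty) (t : ℕ) : i ∈ C.alive t := by
  by_contra h
  exact hi ⟨t, h⟩

theorem CrashPattern.eventually_alive_eq_nonfaulty [Finite V] (C : CrashPattern G) :
    ∀ᶠ t in atTop, C.alive t = C.nonfaulty := by
  have h : ∀ i, ∀ᶠ t in atTop, i ∈ C.alive t → i ∈ C.nonfaulty := fun i => by
    by_cases hi : i ∈ C.nonfaulty
    · exact Eventually.of_forall fun _ _ => hi
    · obtain ⟨s, hs⟩ := not_not.1 hi
      exact eventually_atTop.2 ⟨s, fun t hst ht => absurd (C.alive_antitone hst ht) hs⟩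
  filter_upwards [eventually_all.2 h] with t ht
  exact Set.Subset.antisymm (fun i => ht i) fun i hi => C.mem_alive_of_mem_nonfaulty hi t

open Matrix

open scoped Classical in
/-- The in-neighbors of `i` in the subgraph induced on `N`. -/
noncomputable def inNeighbors (G : Digraph V) (N : Set V) [Fintype N] (i : N) : Finset N :=
  {j : N | G.Adj j i}

open scoped Classical in
/-- The plain averaging matrix of the subgraph induced on `N`. -/
noncomputable def averagingMatrix (G : Digraph V) (N : Set V) [Fintype N] : Matrix N N ℝ :=
  fun i j => ((if j = i then 1 else 0) + if j ∈ inNeighbors G N i then 1 else 0) /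
    ((inNeighbors G N i).card + 1)

variable {N : Set V} [Fintype N]

theorem mem_inNeighbors {i j : N} : j ∈ inNeighbors G N i ↔ G.Adj j i := by
  simp [inNeighbors]

theorem card_inNeighbors_le [Fintype V] (G : Digraph V) (i : N) :
    (inNeighbors G N i).card ≤ maxInDegree G := by
  have h1 : (inNeighbors G N i).card ≤ {j : V | G.Adj j i}.ncard := by
    rw [← Finset.card_map (Function.Embedding.subtype _), ← Set.ncard_coe_finset]
    refine Set.ncard_le_ncard (fun j hj => ?_) (Set.toFinite _)
    obtain ⟨j', hj', rfl⟩ := Finset.mem_map.1 (Finset.mem_coe.1 hj)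
    exact mem_inNeighbors.1 hj'
  exact h1.trans (Finset.le_sup (f := fun i : V => {j : V | G.Adj j i}.ncard)
    (Finset.mem_univ (i : V)))

theorem averagingMatrix_mulVec (y : N → ℝ) (i : N) :
    (averagingMatrix G N *ᵥ y) i =
      (y i + ∑ j ∈ inNeighbors G N i, y j) / ((inNeighbors G N i).card + 1) := by
  simp only [averagingMatrix, mulVec, dotProduct, div_mul_eq_mul_div, ← Finset.sum_div, add_mul,
    Finset.sum_add_distrib, ite_mul, one_mul, zero_mul, Finset.sum_ite_eq', Finset.sum_ite_mem,
    Finset.mem_univ, if_true, Finset.univ_inter]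

theorem averagingMatrix_mem_rowStochastic [DecidableEq N] (G : Digraph V) :
    averagingMatrix G N ∈ rowStochastic ℝ N := by
  refine ⟨fun i j => ?_, funext fun i => ?_⟩
  · refine div_nonneg (add_nonneg ?_ ?_) (by positivity) <;> split_ifs <;> norm_num
  · rw [averagingMatrix_mulVec]
    simp only [Pi.one_apply, Finset.sum_const, nsmul_eq_mul, mul_one]
    rw [add_comm, div_self (by positivity)]

open scoped Classical in
theorem le_averagingMatrix_apply [Fintype V] {i j : N} (hij : j = i ∨ G.Adj j i) :
    1 / ((maxInDegree G : ℝ) + 1) ≤ averagingMatrix G N i j := by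
  have h1 : ((inNeighbors G N i).card : ℝ) ≤ maxInDegree G :=
    Nat.cast_le.2 (card_inNeighbors_le G i)
  rw [averagingMatrix, div_le_div_iff₀ (by positivity) (by positivity), one_mul]
  have h2 : (1 : ℝ) ≤ (if j = i then 1 else 0) + if j ∈ inNeighbors G N i then 1 else 0 := by
    rcases hij with hij | hij
    · rw [if_pos hij]
      split_ifs <;> norm_num
    · rw [if_pos (mem_inNeighbors.2 hij)]
      split_ifs <;> norm_num
  nlinarith [(Nat.cast_nonneg (maxInDegree G) : (0 : ℝ) ≤ _)]

/-- Paths in the reduced graph never leave `N`, so a set closed under out-edges inside `N` contains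
every path from `k`. -/
theorem eq_univ_of_mem_sourceComponent {k : N}
    (hk : (k : V) ∈ sourceComponent (removeEdgesAt G Nᶜ) N) {B : Finset N} (hkB : k ∈ B)
    (hB : ∀ i ∈ B, ∀ j : N, G.Adj i j → j ∈ B) : B = Finset.univ := by
  refine Finset.eq_univ_of_forall fun j => ?_
  by_cases hjk : (j : V) = k
  · rwa [Subtype.ext hjk]
  have hpath : ∀ l : V, Relation.TransGen (removeEdgesAt G Nᶜ).Adj k l →
      ∃ hl : l ∈ N, (⟨l, hl⟩ : N) ∈ B := by
    intro l hl
    induction hl with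
    | single h => exact ⟨not_not.1 h.2.2, hB k hkB _ h.1⟩
    | tail _ h ih =>
      obtain ⟨_, hb⟩ := ih
      exact ⟨not_not.1 h.2.2, hB _ hb _ h.1⟩
  exact (hpath j (hk.2 j j.2 hjk)).2

theorem le_averagingMatrix_pow [Fintype V] [DecidableEq N] {k : N}
    (hk : (k : V) ∈ sourceComponent (removeEdgesAt G Nᶜ) N) (i : N) :
    (1 / ((maxInDegree G : ℝ) + 1)) ^ Fintype.card N ≤
      (averagingMatrix G N ^ Fintype.card N) i k :=
  pow_le_pow_card_apply (averagingMatrix_mem_rowStochastic G) (by positivity)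
    (fun _ => le_averagingMatrix_apply (Or.inl rfl))
    (fun _ hkB hB => eq_univ_of_mem_sourceComponent hk hkB fun i hi j hij =>
      hB i hi j (le_averagingMatrix_apply (Or.inr hij))) i

/-- Once only non-faulty agents are alive, `recv_sound` and `recv_complete` together pin down the
received set. -/
theorem CrashPattern.average_eq_mulVec (C : CrashPattern G)
    [Fintype C.nonfaulty] {t : ℕ} (ht : C.alive t = C.nonfaulty) (x : ℕ → V → ℝ) (i : C.nonfaulty) :
    C.average x t i = (averagingMatrix G C.nonfaulty *ᵥ fun j => x t j) i := by
  have hi := C.mem_alive_of_mem_nonfaulty i.2 (t + 1)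
  have hrecv : C.recv t i = (inNeighbors G C.nonfaulty i).map (Function.Embedding.subtype _) := by
    ext j
    simp only [Finset.mem_map, mem_inNeighbors, Function.Embedding.subtype_apply]
    constructor
    · intro hj
      obtain ⟨hadj, halive⟩ := C.recv_sound t i hi j hj
      exact ⟨⟨j, ht ▸ halive⟩, hadj, rfl⟩
    · rintro ⟨j, hadj, rfl⟩
      exact C.recv_complete t i hi j (C.mem_alive_of_mem_nonfaulty j.2 _) hadj
  rw [averagingMatrix_mulVec, CrashPattern.average, hrecv, Finset.card_map, Finset.sum_map]
  rfl

end Crash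

end CrashOpt

theorem mainTheorem4 {V : Type*} [Fintype V] (G : Digraph V) (hG : ∀ i, ¬ G.Adj i i)
    (X : Set ℝ) (hXne : X.Nonempty) (hXcl : IsClosed X) (hXconv : Convex ℝ X)
    (L : ℝ) (h h' : V → ℝ → ℝ) (hadm : ∀ i, CrashOpt.Admissible X L (h i) (h' i))
    (lam : ℕ → ℝ) (hlam : CrashOpt.IsStepSize lam)
    (C : CrashOpt.CrashPattern G)
    (β : ℝ) (hβ : β ≤ 1 / ((CrashOpt.maxInDegree G : ℝ) + 1) ^ Fintype.card V)
    (γ : ℕ) (hγ : 1 ≤ γ)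
    (hsource : ∀ R ⊆ C.faulty,
      γ ≤ (CrashOpt.sourceComponent (CrashOpt.removeEdgesAt G R) Rᶜ).ncard)
    (x : ℕ → V → ℝ) (hx : CrashOpt.IsTrajectory C X h' lam x) :
    ∃ p ∈ CrashOpt.validFunctions h C.nonfaulty β γ,
      ∃ xopt ∈ CrashOpt.argminOn X p,
        ∀ i ∈ C.nonfaulty, Tendsto (fun t => x t i) atTop (𝓝 xopt) := by
  classical
  have hS : γ ≤ (CrashOpt.sourceComponent (CrashOpt.removeEdgesAt G C.nonfaultyᶜ)
      C.nonfaulty).ncard := by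
    -- Only the reduced graph for `R = C.faulty` matters.
    rw [CrashOpt.CrashPattern.nonfaulty, compl_compl]
    exact hsource C.faulty subset_rfl
  obtain ⟨k, hk⟩ := Set.nonempty_of_ncard_ne_zero (by omega :
    (CrashOpt.sourceComponent (CrashOpt.removeEdgesAt G C.nonfaultyᶜ) C.nonfaulty).ncard ≠ 0)
  have : Nonempty C.nonfaulty := ⟨⟨k, hk.1⟩⟩
  have hA := CrashOpt.averagingMatrix_mem_rowStochastic (N := C.nonfaulty) G
  obtain ⟨π, hπ0, hπ1, hπ⟩ := CrashOpt.exists_stationary hA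
  obtain ⟨T, hT⟩ := eventually_atTop.1 C.eventually_alive_eq_nonfaulty
  -- Starting at `T + 1` rather than `T` ensures one projection has taken place: initial states may
  -- lie outside `X`.
  have hiter : CrashOpt.IsConsensusIteration (CrashOpt.averagingMatrix G C.nonfaulty) X
      (fun i => h' i) (fun t => lam (T + 1 + t)) fun t i => x (T + 1 + t) i :=
    { mem := fun t i => by
        have := (hx.update (T + t) i (C.mem_alive_of_mem_nonfaulty i.2 _)).1
        rwa [add_right_comm] at this
      update := fun t i => by
        have := hx.update (T + 1 + t) i (C.mem_alive_of_mem_nonfaulty i.2 _)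
        rwa [C.average_eq_mulVec (hT _ (by omega))] at this }
  obtain ⟨z, hz, hlim⟩ := hiter.exists_limit hA hXcl hXconv (fun i => hadm i) (hlam.shift _)
    hπ0 hπ1 hπ (pow_pos Nat.one_div_pos_of_nat _)
    (CrashOpt.le_averagingMatrix_pow (k := ⟨k, hk.1⟩) hk)
  let α : V → ℝ := fun i => if hi : i ∈ C.nonfaulty then π ⟨i, hi⟩ else 0
  have hα : ∀ f : V → ℝ, ∑ i, α i * f i = ∑ i : C.nonfaulty, π i * f i := fun f => by
    refine (Finset.sum_of_injOn Subtype.val Subtype.val_injective.injOn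
      (fun _ _ => Finset.mem_univ _) (fun i _ hi => ?_) fun i _ => ?_).symm
    · have hiN : i ∉ C.nonfaulty := fun hiN => hi ⟨⟨i, hiN⟩, Finset.mem_univ _, rfl⟩
      rw [show α i = 0 from dif_neg hiN, zero_mul]
    · rw [show α i = π i from dif_pos i.2]
  refine ⟨fun y => ∑ i, α i * h i y, ⟨α, fun i => ?_, ?_, hS.trans ?_, rfl⟩, z, ?_, fun i hi => ?_⟩
  · dsimp only [α]
    split_ifs
    exacts [hπ0 _, le_rfl]
  · simpa [hπ1] using hα 1
  · refine Set.ncard_le_ncard (fun i hi => ⟨hi.1, ?_⟩) (Set.toFinite _)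
    have hle := CrashOpt.le_stationary hπ0 hπ1 hπ
      (CrashOpt.le_averagingMatrix_pow (k := ⟨i, hi.1⟩) hi)
    have hαi : α i = π ⟨i, hi.1⟩ := dif_pos hi.1
    rw [hαi]
    refine le_trans ?_ hle
    rw [← one_div_pow] at hβ
    -- The stationary bound has exponent `|N| ≤ |V|` and base at most one, so it is at least the one
    -- allowed for `β`.
    refine hβ.trans (pow_le_pow_of_le_one (by positivity) ?_
      (Fintype.card_subtype_le _))
    rw [div_le_one (by positivity)]
    linarith [(Nat.cast_nonneg (CrashOpt.maxInDegree G) : (0 : ℝ) ≤ _)]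
  · simp only [hα fun i => h i _]
    exact hz
  · have := hlim ⟨i, hi⟩
    refine (tendsto_add_atTop_iff_nat (T + 1)).1 (this.congr fun t => ?_)
    dsimp only
    rw [add_comm]
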